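/- Throughout, $\mathbb{R}_{\ge t_0}=[t_0,\infty)$, $\mathrm{B}(0,r)$ and $\overline{\mathrm{B}}(0,r)$ are the open and closed Euclidean balls, $\partial U$ denotes the Clarke gradient of a locally Lipschitz function $U$, and "regular" is meant in the sense of Clarke (the one-sided directional derivatives exist and equal the Clarke generalized directional derivatives). Functions on $\mathcal D\times\mathbb{R}_{\ge t_0}$, with $\mathcal D$ open, are required to be regular at the points with $t>t_0$. Let $\mathcal D\subseteq\mathbb{R}^n$ be an open and connected set containing the origin, let $t_0\in\mathbb{R}$, $\Omega:=\mathcal D\times\mathbb{R}_{\ge t_0}$, and let $F:\mathbb{R}^n\times\mathbb{R}_{\ge t_0}\rightrightarrows\mathbb{R}^n$ be a set-valued map. *Existence assumption.* For every $(x_0,s)\in\mathbb{R}^n\times\mathbb{R}_{\ge t_0}$ there are $a,b>0$ such that on $[s,s+a]\times\overline{\mathrm{B}}(x_0,b)$: for almost every $t$, for all $y$, the set $F(y,t)$ is nonempty, closed and convex and $y\mapsto F(y,t)$ is upper semicontinuous; and there is an integrable function $m$ on $[s,s+a]$ such that for each $y$ there is a measurable selection $t\mapsto g(y,t)\in F(y,t)$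 with $\|g(y,t)\|\le m(t)$ for almost every $t$. *Local boundedness, uniformly in $t$, over $\Omega$.* For every compact $K\subset\mathcal D$ there is $M>0$ with $\|q\|\le M$ for all $x\in K$, $t\ge t_0$, $q\in F(x,t)$. *Reduced set and $\mathcal V$-non-strict Lyapunov functions.* Let $\mathcal V$ be a countable collection of locally Lipschitz regular functions $U:\Omega\to\mathbb{R}$ and put $$\tilde F(x,t):=\{q\in F(x,t)\mid \text{for each } U\in\mathcal V \text{ the value } p^T[q;1] \text{ is the same for all } p\in\partial U(x,t)\}.$$ A locally Lipschitz regular function $V:\Omega\to\mathbb{R}$ is a $\mathcal V$-non-strict Lyapunov function for $F$ over $\Omega$ with the bounds $\overline W,\underline W,W:\mathcal D\to\mathbb{R}$ if $\overline W,\underline W$ are continuous and positive definite, $W$ is continuous and positive semidefinite (only $W\ge 0$ is needed), $\underline W(x)\le V(x,t)\le\overline W(x)$ for all $(x,t)\in\Omega$, and for almost every $t\ge t_0$, $$\dot{\underline V}_{\tilde F}(x,t):=\min_{p\in\partial V(x,t)}\ \max_{q\in\tilde F(x,t)}p^T[q;1]\ \le\ -W(x)\qquad\text{for all }x\in\mathcal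 D,$$ where $\dot{\underline V}_{\tilde F}(x,t):=-\infty$ if $\tilde F(x,t)=\emptyset$. A solution of $\dot x\in F(x,t)$ on $[t_0,T)$, $t_0<T\le\infty$, is a locally absolutely continuous $x:[t_0,T)\to\mathbb{R}^n$ with $\dot x(t)\in F(x(t),t)$ for almost every $t$; it is maximal if it has no extension to a solution on a strictly longer interval $[t_0,T')$, and complete if $T=\infty$. **Corollary.** Assume that $F$ satisfies the existence assumption and is locally bounded, uniformly in $t$, over $\Omega$, and that $\dot x\in F(x,t)$ admits a $\mathcal V$-non-strict Lyapunov function over $\Omega$ with the bounds $\overline W,\underline W,W$. Let $r>0$ with $\overline{\mathrm{B}}(0,r)\subset\mathcal D$ and let $0<c<\min_{\|y\|=r}\underline W(y)$. Then every solution $x$ with $x(t_0)\in\{y\in\mathrm{B}(0,r)\mid\overline W(y)\le c\}$ is bounded and can be extended to a complete solution, every maximal such solution is complete, and every complete such solution satisfies $\lim_{t\to\infty}W(x(t))=0$. -/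

import Mathlib

open Set Filter Topology MeasureTheory

noncomputable section

/-! ### Clarke's generalized gradient and regularity -/

section Clarke

variable {X : Type*} [NormedAddCommGroup X] [NormedSpace ℝ X]

/-- Clarke's generalized directional derivative
`f°(z; v) = limsup_{y → z, h ↓ 0} (f (y + h v) - f y) / h`, with values in the extended reals
(it is finite wherever `f` is Lipschitz near `z`). -/
def clarkeDirDeriv (f : X → ℝ) (z v : X) : EReal :=
  limsup (fun p : X × ℝ => (((f (p.1 + p.2 • v) - f p.1) / p.2 : ℝ) : EReal)) (𝓝 z ×ˢ 𝓝[>] 0)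

/-- Clarke's generalized gradient `∂f(z)`, a set of continuous linear functionals. -/
def clarkeGradient (f : X → ℝ) (z : X) : Set (X →L[ℝ] ℝ) :=
  {p | ∀ v : X, ((p v : ℝ) : EReal) ≤ clarkeDirDeriv f z v}

/-- `f` is regular at `z` in the sense of Clarke: for every direction `v` the one-sided
directional derivative `f'(z; v)` exists and equals `f°(z; v)`. -/
def ClarkeRegularAt (f : X → ℝ) (z : X) : Prop :=
  ∀ v : X, ∃ d : ℝ,
    Tendsto (fun h : ℝ => (f (z + h • v) - f z) / h) (𝓝[>] 0) (𝓝 d) ∧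
      (d : EReal) = clarkeDirDeriv f z v

end Clarke

section Inclusion

variable {E : Type*} [NormedAddCommGroup E] [NormedSpace ℝ E]

/-! ### Differential inclusions `ẋ ∈ F(x, t)` -/

/-- The right-open time interval `[t₀, T)`, where `T = ⊤` is allowed. -/
def timeInterval (t₀ : ℝ) (T : EReal) : Set ℝ := {t : ℝ | t₀ ≤ t ∧ (t : EReal) < T}

/-- `x` is a solution of `ẋ ∈ F(x, t)` on `[t₀, T)`: it is locally absolutely continuous there and
its derivative exists and satisfies the inclusion for almost every `t`. -/
structure IsInclusionSolution (F : E → ℝ → Set E) (t₀ : ℝ) (T : EReal) (x : ℝ → E) : Prop where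
  lt : (t₀ : EReal) < T
  absCont : ∀ b ∈ timeInterval t₀ T, AbsolutelyContinuousOnInterval x t₀ b
  deriv_mem : ∀ᵐ t : ℝ, t ∈ timeInterval t₀ T → ∃ v ∈ F (x t) t, HasDerivAt x v t

/-- A solution on `[t₀, T)` that has no extension to a solution on a strictly longer interval. -/
def IsMaximalInclusionSolution (F : E → ℝ → Set E) (t₀ : ℝ) (T : EReal) (x : ℝ → E) : Prop :=
  IsInclusionSolution F t₀ T x ∧
    ∀ (T' : EReal) (y : ℝ → E), IsInclusionSolution F t₀ T' y → T ≤ T' →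
      EqOn y x (timeInterval t₀ T) → T' = T

/-- Filippov's hypotheses for local existence of solutions starting from `(x₀, s)`, on the cylinder
`s ≤ t ≤ s + a`, `‖y - x₀‖ ≤ b`: for almost every `t` the values `F(y, t)` are nonempty, closed and
convex and `y ↦ F(y, t)` is upper semicontinuous; for every `y` there is a measurable selection
`t ↦ g(y, t) ∈ F(y, t)`; and the selections are bounded in norm by one integrable function of `t`. -/
structure FilippovLocalHyp (F : E → ℝ → Set E) (x₀ : E) (s a b : ℝ) : Prop where
  values : ∀ᵐ t ∂(volume.restrict (Icc s (s + a))), ∀ y ∈ Metric.closedBall x₀ b,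
    (F y t).Nonempty ∧ IsClosed (F y t) ∧ Convex ℝ (F y t)
  usc : ∀ᵐ t ∂(volume.restrict (Icc s (s + a))), ∀ y ∈ Metric.closedBall x₀ b,
    ∀ ε > 0, ∀ᶠ y' in 𝓝[Metric.closedBall x₀ b] y, F y' t ⊆ Metric.thickening ε (F y t)
  selection : ∃ (g : E → ℝ → E) (m : ℝ → ℝ), IntegrableOn m (Icc s (s + a)) ∧
    ∀ y ∈ Metric.closedBall x₀ b,
      AEStronglyMeasurable (g y) (volume.restrict (Icc s (s + a))) ∧
      ∀ᵐ t ∂(volume.restrict (Icc s (s + a))), g y t ∈ F y t ∧ ‖g y t‖ ≤ m t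

/-- The existence assumption on `F : E × [t₀, ∞) ⇉ E`: Filippov's hypotheses hold on some cylinder
issuing from every initial point `(x₀, s)` with `s ≥ t₀`. -/
def ExistenceAssumption (F : E → ℝ → Set E) (t₀ : ℝ) : Prop :=
  ∀ (x₀ : E) (s : ℝ), t₀ ≤ s → ∃ a > 0, ∃ b > 0, FilippovLocalHyp F x₀ s a b

/-- `F` is locally bounded, uniformly in `t`, over `D × [t₀, ∞)`. -/
def LocallyBoundedUniformly (F : E → ℝ → Set E) (D : Set E) (t₀ : ℝ) : Prop :=
  ∀ K ⊆ D, IsCompact K → ∃ M > 0, ∀ x ∈ K, ∀ t, t₀ ≤ t → ∀ y ∈ F x t, ‖y‖ ≤ M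

/-! ### Reduction of the inclusion and Lyapunov functions -/

/-- The directions `q ∈ F(x, t)` for which `pᵀ[q; 1]` takes the same value for all
`p ∈ ∂U(x, t)`. -/
def reducedBy (F : E → ℝ → Set E) (U : E × ℝ → ℝ) (x : E) (t : ℝ) : Set E :=
  {q ∈ F x t | ∃ a : ℝ, ∀ p ∈ clarkeGradient U (x, t), p (q, 1) = a}

/-- The reduced set `F̃(x, t)`: the intersection of `F(x, t)` with all `reducedBy F U x t`,
`U ∈ 𝒱`. -/
def reducedInclusion (F : E → ℝ → Set E) (𝒱 : Set (E × ℝ → ℝ)) (x : E) (t : ℝ) : Set E :=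
  F x t ∩ ⋂ U ∈ 𝒱, reducedBy F U x t

/-- The generalized time derivative `min_{p ∈ ∂V(x,t)} max_{q ∈ H(x,t)} pᵀ[q; 1]` of `V` with
respect to `H`, with values in the extended reals; it is `-∞` where `H(x, t)` is empty
(and `∂V(x, t)` is not). -/
def lowerTimeDeriv (V : E × ℝ → ℝ) (H : E → ℝ → Set E) (x : E) (t : ℝ) : EReal :=
  ⨅ p ∈ clarkeGradient V (x, t), ⨆ q ∈ H x t, ((p (q, 1) : ℝ) : EReal)

/-- A locally Lipschitz function on `D × [t₀, ∞)` that is regular in Clarke's sense; `D` is an open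
set, and regularity is meant at the interior points of the domain, where the Clarke derivative does
not depend on values outside the domain. -/
def IsLipschitzRegular (D : Set E) (t₀ : ℝ) (U : E × ℝ → ℝ) : Prop :=
  LocallyLipschitzOn (D ×ˢ Ici t₀) U ∧ ∀ z ∈ D ×ˢ Ioi t₀, ClarkeRegularAt U z

/-- A continuous positive definite function on `D`. -/
def IsContPosDef (D : Set E) (w : E → ℝ) : Prop :=
  ContinuousOn w D ∧ w 0 = 0 ∧ ∀ x ∈ D, x ≠ 0 → 0 < w x

/-- `V` is a `𝒱`-non-strict Lyapunov function for `F` over `D × [t₀, ∞)` with the bounds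
`Wup`, `Wlow` and `W`. -/
structure IsReducedNonStrictLyapunov (D : Set E) (t₀ : ℝ) (F : E → ℝ → Set E)
    (𝒱 : Set (E × ℝ → ℝ)) (V : E × ℝ → ℝ) (Wup Wlow W : E → ℝ) : Prop where
  regular : IsLipschitzRegular D t₀ V
  upper_posDef : IsContPosDef D Wup
  lower_posDef : IsContPosDef D Wlow
  bounds : ∀ x ∈ D, ∀ t, t₀ ≤ t → Wlow x ≤ V (x, t) ∧ V (x, t) ≤ Wup x
  countable : 𝒱.Countable
  family_regular : ∀ U ∈ 𝒱, IsLipschitzRegular D t₀ U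
  rate_cont : ContinuousOn W D
  rate_nonneg : ∀ x ∈ D, 0 ≤ W x
  decrease : ∀ᵐ t ∂(volume.restrict (Ici t₀)), ∀ x ∈ D,
    lowerTimeDeriv V (reducedInclusion F 𝒱) x t ≤ ((-W x : ℝ) : EReal)

end Inclusion

end

/-! Let `x` be a solution. For almost every `t`, the curve and all the functions `U (x t, t)`, `U ∈
𝒱`, and `V (x t, t)` are differentiable. Regularity then forces every `p` in the Clarke gradient to
take at the velocity `(ẋ, 1)` the value of the time derivative
(`ClarkeRegularAt.apply_eq_of_hasDerivAt`): the directional derivative bounds `p` from above in the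
directions `(ẋ, 1)` and `-(ẋ, 1)`. Hence `ẋ` lies in the reduced set, the min-max bound applies to
it, and integration gives `V(x(b), b) + ∫ W(x) ≤ V(x(t₀), t₀)`
(`IsReducedNonStrictLyapunov.add_integral_le`).

This has two consequences. On the sphere of radius `r`, `V ≥ Wlow > c`, while `V ≤ c` along the
solution, so the sphere is never reached. In the ball the velocities are bounded, so `x` is
Lipschitz and `W ∘ x` is uniformly continuous with bounded integrals; Barbalat's lemma gives
`W(x(t)) → 0`.

For completeness, Zorn's lemma extends `x` to a maximal solution. If that ended at a finite time, it
would have a limit in the closed ball, and Filippov's local existence theorem would continue it. The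
local theorem comes from Euler curves, Arzelà–Ascoli, and the stability of closed convex velocity
constraints under limits (`ae_hasDerivAt_mem_of_tendsto_integral`). -/

/-! ### Absolutely continuous functions -/

namespace AbsolutelyContinuousOnInterval

variable {X Y : Type*} [PseudoMetricSpace X] [PseudoMetricSpace Y]

/-- A function whose increments are controlled by those of an absolutely continuous function and
by the time increments is absolutely continuous. -/
theorem of_dist_le {f : ℝ → X} {g : ℝ → Y} {a b K : ℝ} (hf : AbsolutelyContinuousOnInterval f a b)
    (h : ∀ s ∈ uIcc a b, ∀ t ∈ uIcc a b, dist (g s) (g t) ≤ K * (dist (f s) (f t) + dist s t)) :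
    AbsolutelyContinuousOnInterval g a b := by
  have hid : AbsolutelyContinuousOnInterval (fun t : ℝ => t) a b :=
    (LipschitzWith.id.lipschitzOnWith (s := uIcc a b)).absolutelyContinuousOnInterval
  have hlim := (Tendsto.add hf hid).const_mul K
  rw [add_zero, mul_zero] at hlim
  refine squeeze_zero' (Eventually.of_forall fun I => Finset.sum_nonneg fun i _ => dist_nonneg)
    ?_ hlim
  filter_upwards [mem_inf_of_right (mem_principal_self _)] with I hI
  rw [← Finset.sum_add_distrib, Finset.mul_sum]
  exact Finset.sum_le_sum fun i hi => h _ (hI.1 i hi).1 _ (hI.1 i hi).2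

theorem congr_on {f g : ℝ → X} {a b : ℝ} (hf : AbsolutelyContinuousOnInterval f a b)
    (h : EqOn g f (uIcc a b)) : AbsolutelyContinuousOnInterval g a b := by
  refine hf.of_dist_le (K := 1) fun s hs t ht => ?_
  rw [h hs, h ht, one_mul]
  exact le_add_of_nonneg_right dist_nonneg

/-- The increment of an absolutely continuous curve is bounded by the time increment times a bound
on its derivative. -/
theorem norm_sub_le {E : Type*} [NormedAddCommGroup E] [InnerProductSpace ℝ E] {x : ℝ → E}
    {a b M : ℝ} (hx : AbsolutelyContinuousOnInterval x a b) (hab : a ≤ b)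
    (h : ∀ᵐ t : ℝ, t ∈ Icc a b → ∃ v, ‖v‖ ≤ M ∧ HasDerivAt x v t) :
    ‖x b - x a‖ ≤ M * (b - a) := by
  -- Pairing the curve with its own increment reduces the claim to the scalar fundamental theorem of
  -- calculus, which yields `‖w‖² ≤ ‖w‖ M (b - a)`.
  set w := x b - x a with hw
  have hAC : AbsolutelyContinuousOnInterval (fun t => inner ℝ w (x t)) a b := by
    refine hx.of_dist_le (K := ‖w‖) fun s _ t _ => ?_
    rw [Real.dist_eq, ← inner_sub_right, dist_eq_norm]
    refine (abs_real_inner_le_norm _ _).trans ?_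
    gcongr
    exact le_add_of_nonneg_right dist_nonneg
  have hsub := hAC.integral_deriv_eq_sub
  have hle : ‖∫ t in a..b, deriv (fun t => inner ℝ w (x t)) t‖ ≤ (‖w‖ * M) * |b - a| := by
    refine intervalIntegral.norm_integral_le_of_norm_le_const_ae ?_
    filter_upwards [h] with t ht htm
    rw [uIoc_of_le hab] at htm
    obtain ⟨v, hv, hd⟩ := ht (Ioc_subset_Icc_self htm)
    have hd' : HasDerivAt (fun t => inner ℝ w (x t)) (inner ℝ w v) t := by
      simpa using (hasDerivAt_const t w).inner ℝ hd
    rw [hd'.deriv]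
    exact (norm_inner_le_norm _ _).trans (by gcongr)
  rw [hsub, ← inner_sub_right, ← hw, real_inner_self_eq_norm_sq, abs_of_nonneg (sub_nonneg.2 hab),
    Real.norm_of_nonneg (by positivity)] at hle
  -- If `w = 0`, the claim is `0 ≤ M (b - a)`: a negative `M` would leave no admissible velocity on
  -- an interval of positive measure.
  by_cases h0 : ‖w‖ = 0
  · rw [h0]
    by_contra! hneg
    rcases hab.eq_or_lt with rfl | hlt
    · simp at hneg
    have hM : M < 0 := by
      by_contra! hM
      exact absurd (mul_nonneg hM (sub_nonneg.2 hab)) (not_le.2 hneg)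
    have : ∀ᵐ t : ℝ, t ∉ Icc a b := by
      filter_upwards [h] with t ht htm
      obtain ⟨v, hv, -⟩ := ht htm
      exact absurd ((norm_nonneg v).trans hv) (not_le.2 hM)
    rw [measure_eq_zero_iff_ae_notMem.symm, Real.volume_Icc] at this
    simp at this
    linarith
  · have : 0 < ‖w‖ := lt_of_le_of_ne (norm_nonneg _) (Ne.symm h0)
    nlinarith

end AbsolutelyContinuousOnInterval

/-! ### A chain rule for regular functions along differentiable curves -/

section Clarke

variable {X : Type*} [NormedAddCommGroup X] [NormedSpace ℝ X]

/-- If `f` is Lipschitz near `γ t` and `γ` has derivative `v` at `t`, the difference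
quotients of `f ∘ γ` and of `f` along the direction `v` have the same limits. -/
theorem LipschitzOnWith.tendsto_comp_slope_sub {f : X → ℝ} {γ : ℝ → X} {t : ℝ} {v : X}
    {K : NNReal} {s : Set X} (hs : s ∈ 𝓝 (γ t)) (hf : LipschitzOnWith K f s)
    (hγ : HasDerivAt γ v t) :
    Tendsto (fun h : ℝ => h⁻¹ * (f (γ (t + h)) - f (γ t + h • v))) (𝓝[≠] 0) (𝓝 0) := by
  have h1 := hasDerivAt_iff_tendsto_slope_zero.1 hγ
  have h2 : Tendsto (fun h : ℝ => K * ‖h⁻¹ • (γ (t + h) - γ t) - v‖) (𝓝[≠] 0) (𝓝 0) := by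
    simpa using ((h1.sub_const v).norm).const_mul (K : ℝ)
  have hc1 : Tendsto (fun h : ℝ => γ (t + h)) (𝓝[≠] 0) (𝓝 (γ t)) := by
    have : ContinuousAt (fun h : ℝ => γ (t + h)) 0 := by
      refine ContinuousAt.comp (g := γ) ?_ (by fun_prop)
      simpa using hγ.continuousAt
    simpa using this.tendsto.mono_left nhdsWithin_le_nhds
  have hc2 : Tendsto (fun h : ℝ => γ t + h • v) (𝓝[≠] 0) (𝓝 (γ t)) := by
    have : Continuous (fun h : ℝ => γ t + h • v) := by fun_prop
    simpa using (this.tendsto 0).mono_left nhdsWithin_le_nhds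
  refine squeeze_zero_norm' ?_ h2
  filter_upwards [hc1 hs, hc2 hs, self_mem_nhdsWithin] with h m1 m2 hne
  have hne : h ≠ 0 := hne
  have := hf.dist_le_mul _ m1 _ m2
  rw [Real.dist_eq, dist_eq_norm] at this
  have e : h⁻¹ • (γ (t + h) - γ t) - v = h⁻¹ • (γ (t + h) - (γ t + h • v)) := by
    rw [← sub_sub, smul_sub h⁻¹ (_ - _) (h • v), inv_smul_smul₀ hne]
  rw [e, norm_smul, norm_mul, Real.norm_eq_abs (_ - _)]
  calc ‖h⁻¹‖ * _ ≤ ‖h⁻¹‖ * (K * ‖γ (t + h) - (γ t + h • v)‖) := by gcongr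
    _ = _ := by ring

/-- Along a differentiable curve on which a regular function `f` has a time derivative, this
derivative is the value of every element of the generalized gradient at the velocity. -/
theorem ClarkeRegularAt.apply_eq_of_hasDerivAt {f : X → ℝ} {γ : ℝ → X} {t d : ℝ} {v : X}
    {K : NNReal} {s : Set X} (hreg : ClarkeRegularAt f (γ t)) (hs : s ∈ 𝓝 (γ t))
    (hf : LipschitzOnWith K f s) (hγ : HasDerivAt γ v t)
    (hd : HasDerivAt (fun τ => f (γ τ)) d t) {p : X →L[ℝ] ℝ} (hp : p ∈ clarkeGradient f (γ t)) :
    p v = d := by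
  have hdir : Tendsto (fun h : ℝ => h⁻¹ * (f (γ t + h • v) - f (γ t))) (𝓝[≠] 0) (𝓝 d) := by
    have := (hasDerivAt_iff_tendsto_slope_zero.1 hd).sub (hf.tendsto_comp_slope_sub hs hγ)
    rw [sub_zero] at this
    refine this.congr fun h => ?_
    rw [smul_eq_mul]
    ring
  have key : ∀ w : X, ∀ e : ℝ,
      Tendsto (fun h : ℝ => h⁻¹ * (f (γ t + h • w) - f (γ t))) (𝓝[>] 0) (𝓝 e) → p w ≤ e := by
    intro w e he
    obtain ⟨d', hd', hcl⟩ := hreg w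
    have : d' = e := tendsto_nhds_unique hd' (he.congr fun h => by rw [div_eq_inv_mul])
    have := hp w
    rw [← hcl] at this
    rw [← ‹d' = e›]
    exact_mod_cast this
  refine le_antisymm (key v d (hdir.mono_left (nhdsWithin_mono _ fun h hh => ne_of_gt hh))) ?_
  -- The limit `hdir` is two-sided, so the derivative in direction `-v` is `-d`; `key` there gives
  -- the reverse inequality.
  have hneg : Tendsto (fun h : ℝ => -h) (𝓝[>] 0) (𝓝[≠] 0) := by
    refine tendsto_nhdsWithin_iff.2 ⟨?_, ?_⟩
    · simpa using (continuous_neg.tendsto (0 : ℝ)).mono_left nhdsWithin_le_nhds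
    · filter_upwards [self_mem_nhdsWithin] with h hh
      simpa using ne_of_gt (mem_Ioi.1 hh)
  have := key (-v) (-d) ((hdir.comp hneg).neg.congr fun h => by simp)
  rw [map_neg] at this
  linarith

end Clarke

/-! ### Separation by a dense sequence of directions -/

/-- A point outside a bounded closed convex set is strictly separated from it by an element of a
given dense sequence of directions. -/
theorem exists_separating_of_denseRange {E : Type*} [NormedAddCommGroup E] [InnerProductSpace ℝ E]
    [CompleteSpace E] {v : ℕ → E} (hv : DenseRange v) {C : Set E} (hC : Convex ℝ C)
    (hcl : IsClosed C) {M : ℝ} (hM : ∀ c ∈ C, ‖c‖ ≤ M) {w : E} (hw : w ∉ C) :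
    ∃ j, ∃ u : ℝ, (∀ c ∈ C, inner ℝ (v j) c < u) ∧ u < inner ℝ (v j) w := by
  obtain ⟨f, u, hf, hu⟩ := geometric_hahn_banach_closed_point hC hcl hw
  set z := (InnerProductSpace.toDual ℝ E).symm f with hz
  have hfz : ∀ y, f y = inner ℝ z y := fun y => by rw [hz, InnerProductSpace.toDual_symm_apply]
  set R := |M| + ‖w‖ + 1 with hR
  have hRpos : 0 < R := by positivity
  -- Replacing `z` by a direction within `η / R` changes values on the ball of radius `R`, which
  -- contains `C` and `w`, by less than `η`; a third of the gap survives.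
  set η := (f w - u) / 3 with hη
  have hηpos : 0 < η := by rw [hη]; linarith
  obtain ⟨j, hj⟩ := hv.exists_dist_lt z (div_pos hηpos hRpos)
  have hbd : ∀ y, ‖y‖ ≤ R → |inner ℝ (v j) y - f y| < η := by
    intro y hy
    rw [hfz, ← inner_sub_left]
    refine (abs_real_inner_le_norm _ _).trans_lt ?_
    rw [dist_comm, dist_eq_norm, lt_div_iff₀ hRpos] at hj
    exact (mul_le_mul_of_nonneg_left hy (norm_nonneg _)).trans_lt hj
  refine ⟨j, u + η, fun c hc => ?_, ?_⟩
  · have h1 := hbd c (by linarith [hM c hc, le_abs_self M, norm_nonneg w])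
    linarith [abs_lt.1 h1, hf c hc]
  · have h1 := hbd w (by linarith [abs_nonneg M])
    have := abs_lt.1 h1
    linarith

/-! ### Barbalat's lemma -/

/-- A nonnegative uniformly continuous function on `[a, ∞)` with bounded integrals tends to `0`. -/
theorem UniformContinuousOn.tendsto_zero_of_integral_le {f : ℝ → ℝ} {a C : ℝ}
    (hf : UniformContinuousOn f (Ici a)) (h0 : ∀ t ∈ Ici a, 0 ≤ f t)
    (hC : ∀ b ∈ Ici a, ∫ t in a..b, f t ≤ C) : Tendsto f atTop (𝓝 0) := by
  have hint : ∀ b ∈ Ici a, ∀ c ∈ Ici a, IntervalIntegrable f volume b c := fun b hb c hc =>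
    (hf.continuousOn.mono (fun t ht => le_trans (le_min hb hc) ht.1)).intervalIntegrable
  have hmono : ∀ b ∈ Ici a, ∀ c, b ≤ c → ∫ t in a..b, f t ≤ ∫ t in a..c, f t := by
    intro b hb c hbc
    have hc : c ∈ Ici a := le_trans hb hbc
    rw [← intervalIntegral.integral_add_adjacent_intervals (hint a self_mem_Ici b hb)
      (hint b hb c hc)]
    exact le_add_of_nonneg_right
      (intervalIntegral.integral_nonneg hbc fun t ht => h0 t (le_trans hb ht.1))
  rw [Metric.tendsto_atTop]
  by_contra! hcon
  obtain ⟨ε, hε, hcon⟩ := hcon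
  obtain ⟨δ, hδ, hunif⟩ := Metric.uniformContinuousOn_iff.1 hf (ε / 2) (half_pos hε)
  set η := δ / 2 with hη
  have hηpos : 0 < η := half_pos hδ
  -- Each late time with `f ≥ ε` carries a bump of width `η` and height at least `ε / 2`;
  -- arbitrarily many disjoint bumps contradict the bound `C`.
  have hstep : ∀ N : ℕ, ∃ b ∈ Ici a, (N : ℝ) * (η * (ε / 2)) ≤ ∫ t in a..b, f t := by
    intro N
    induction N with
    | zero => exact ⟨a, self_mem_Ici, by simp⟩
    | succ N ih =>
      obtain ⟨b, hb, hN⟩ := ih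
      obtain ⟨c, hbc, hc⟩ := hcon b
      have hca : c ∈ Ici a := le_trans hb hbc
      have hca' : c + η ∈ Ici a := le_trans (mem_Ici.1 hca) (by linarith)
      refine ⟨c + η, hca', ?_⟩
      rw [Real.dist_eq, sub_zero, abs_of_nonneg (h0 c hca)] at hc
      have hlow : ∀ t ∈ Icc c (c + η), ε / 2 ≤ f t := by
        intro t ht
        have := hunif t (le_trans (mem_Ici.1 hca) ht.1) c hca (by
          rw [Real.dist_eq, abs_of_nonneg (by linarith [ht.1])]
          linarith [ht.2])
        rw [Real.dist_eq] at this
        linarith [(abs_lt.1 this).1]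
      have hI : η * (ε / 2) ≤ ∫ t in c..(c + η), f t := by
        have := intervalIntegral.integral_mono_on (μ := volume) (a := c) (b := c + η)
          (f := fun _ => ε / 2) (by linarith) (by simp) (hint c hca _ hca') hlow
        rwa [intervalIntegral.integral_const, add_sub_cancel_left, smul_eq_mul] at this
      rw [← intervalIntegral.integral_add_adjacent_intervals (hint a self_mem_Ici c hca)
        (hint c hca _ hca')]
      have := hmono b hb c hbc
      push_cast
      linarith
  obtain ⟨N, hN⟩ := exists_nat_gt (C / (η * (ε / 2)))
  obtain ⟨b, hb, hle⟩ := hstep N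
  rw [div_lt_iff₀ (by positivity)] at hN
  linarith [hC b hb]

/-! ### Local existence of solutions -/

section Existence

variable {E : Type*} [NormedAddCommGroup E] [InnerProductSpace ℝ E]

theorem intervalIntegrable_of_ae_norm_le {G : Type*} [NormedAddCommGroup G] {u : ℝ → G} {M : ℝ}
    (hu : AEStronglyMeasurable u volume) (hM : ∀ᵐ t : ℝ, ‖u t‖ ≤ M) (a b : ℝ) :
    IntervalIntegrable u volume a b :=
  intervalIntegrable_iff.2 <| Measure.integrableOn_of_bounded (by simp [uIoc]) hu
    (ae_restrict_of_ae hM)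

/-- Closed convex constraints on a sequence of velocities pass to the derivative of a limit curve. -/
theorem ae_hasDerivAt_mem_of_tendsto_integral [FiniteDimensional ℝ E] {x : ℝ → E}
    {u : ℕ → ℝ → E} {a b M : ℝ}
    (hu : ∀ k, AEStronglyMeasurable (u k) volume) (hM : ∀ k, ∀ᵐ t : ℝ, ‖u k t‖ ≤ M)
    (hlim : ∀ s ∈ Icc a b, ∀ t ∈ Icc a b,
      Tendsto (fun k => ∫ τ in s..t, u k τ) atTop (𝓝 (x t - x s))) :
    ∀ᵐ t : ℝ, t ∈ Ioo a b → ∀ w, HasDerivAt x w t → ∀ C : Set E, IsClosed C → Convex ℝ C →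
      (∃ R : ℝ, ∀ c ∈ C, ‖c‖ ≤ R) → (∀ᶠ k in atTop, u k t ∈ C) → w ∈ C := by
  set v : ℕ → E := TopologicalSpace.denseSeq E with hv
  -- The support function, in direction `v j`, of the velocities from index `K` on. There are
  -- countably many pairs `(j, K)`, so one null set serves all `w` and `C`.
  set ψ : ℕ → ℕ → ℝ → ℝ := fun j K t => ⨆ k, inner ℝ (v j) (u (K + k) t) with hψ
  have hMall : ∀ᵐ t : ℝ, ∀ k, ‖u k t‖ ≤ M := ae_all_iff.2 hM
  have hinner : ∀ j k t, ‖u k t‖ ≤ M → |inner ℝ (v j) (u k t)| ≤ ‖v j‖ * M := fun j k t h =>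
    (abs_real_inner_le_norm _ _).trans (by gcongr)
  have hbdd : ∀ t, (∀ k, ‖u k t‖ ≤ M) → ∀ j K,
      BddAbove (range fun k => inner ℝ (v j) (u (K + k) t)) := by
    rintro t ht j K
    refine ⟨‖v j‖ * M, ?_⟩
    rintro _ ⟨k, rfl⟩
    exact (abs_le.1 (hinner j _ t (ht _))).2
  have hψm : ∀ j K, AEStronglyMeasurable (ψ j K) volume := fun j K =>
    (AEMeasurable.iSup fun k =>
      (aestronglyMeasurable_const.inner (𝕜 := ℝ) (hu (K + k))).aemeasurable).aestronglyMeasurable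
  have hψb : ∀ j K, ∀ᵐ t : ℝ, ‖ψ j K t‖ ≤ ‖v j‖ * M := by
    intro j K
    filter_upwards [hMall] with t ht
    rw [Real.norm_eq_abs, abs_le]
    exact ⟨(abs_le.1 (hinner j _ t (ht _))).1.trans (le_ciSup (hbdd t ht j K) 0),
      ciSup_le fun k => (abs_le.1 (hinner j _ t (ht _))).2⟩
  have hψi : ∀ j K s t, IntervalIntegrable (ψ j K) volume s t := fun j K =>
    intervalIntegrable_of_ae_norm_le (hψm j K) (hψb j K)
  have hle : ∀ j K, ∀ s ∈ Icc a b, ∀ t ∈ Icc a b, s ≤ t →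
      inner ℝ (v j) (x t - x s) ≤ ∫ τ in s..t, ψ j K τ := by
    intro j K s hs t ht hst
    refine le_of_tendsto (tendsto_const_nhds.inner (hlim s hs t ht)) ?_
    filter_upwards [eventually_ge_atTop K] with k hk
    obtain ⟨m, rfl⟩ := Nat.exists_eq_add_of_le hk
    have hui := intervalIntegrable_of_ae_norm_le (hu (K + m)) (hM (K + m)) s t
    have e : inner ℝ (v j) (∫ τ in s..t, u (K + m) τ) =
        ∫ τ in s..t, inner ℝ (v j) (u (K + m) τ) :=
      ((innerSL ℝ (v j)).intervalIntegral_comp_comm hui).symm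
    rw [e]
    refine intervalIntegral.integral_mono_ae hst ?_ (hψi j K s t) ?_
    · exact intervalIntegrable_of_ae_norm_le
        (aestronglyMeasurable_const.inner (𝕜 := ℝ) (hu (K + m)))
        ((hM (K + m)).mono fun τ hτ => hinner j _ τ hτ) s t
    · filter_upwards [hMall] with τ hτ
      exact le_ciSup (hbdd τ hτ j K) m
  have hder : ∀ᵐ t : ℝ, ∀ j K, t ∈ uIcc a b → ∀ c ∈ uIcc a b,
      HasDerivAt (fun t => ∫ τ in c..t, ψ j K τ) (ψ j K t) t :=
    ae_all_iff.2 fun j => ae_all_iff.2 fun K => (hψi j K a b).ae_hasDerivAt_integral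
  filter_upwards [hder, hMall] with t ht htM htab w hw C hCcl hCconv hCb hev
  by_contra hwC
  obtain ⟨R, hR⟩ := hCb
  obtain ⟨j, r, hr, hrw⟩ := exists_separating_of_denseRange
    (TopologicalSpace.denseRange_denseSeq E) hCconv hCcl hR hwC
  obtain ⟨K, hK⟩ := eventually_atTop.1 hev
  have hab : a ≤ b := (htab.1.trans htab.2).le
  have hψr : ψ j K t ≤ r := ciSup_le fun k => (hr _ (hK _ (Nat.le_add_right K k))).le
  -- This function is monotone by `hle`, yet separation makes its derivative at `t` negative.
  have hG : HasDerivAt (fun τ => (∫ σ in a..τ, ψ j K σ) - inner ℝ (v j) (x τ))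
      (ψ j K t - inner ℝ (v j) w) t := by
    refine (ht j K ?_ a left_mem_uIcc).sub ?_
    · rw [uIcc_of_le hab]
      exact Ioo_subset_Icc_self htab
    · simpa using (hasDerivAt_const t (v j)).inner ℝ hw
  have hmono : MonotoneOn (fun τ => (∫ σ in a..τ, ψ j K σ) - inner ℝ (v j) (x τ)) (Icc a b) := by
    intro τ hτ σ hσ hτσ
    have h1 := hle j K τ hτ σ hσ hτσ
    have h2 := intervalIntegral.integral_add_adjacent_intervals (hψi j K a τ) (hψi j K τ σ)
    rw [inner_sub_right] at h1
    dsimp only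
    linarith
  have hnn := hmono.derivWithin_nonneg (x := t)
  rw [derivWithin_of_mem_nhds (Icc_mem_nhds htab.1 htab.2), hG.deriv] at hnn
  have hwv : r < inner ℝ (v j) w := hrw
  linarith

theorem FilippovLocalHyp.mono {F : E → ℝ → Set E} {x₀ : E} {s a b a' b' : ℝ}
    (h : FilippovLocalHyp F x₀ s a b) (ha : a' ≤ a) (hb : b' ≤ b) :
    FilippovLocalHyp F x₀ s a' b' := by
  have hI : Icc s (s + a') ⊆ Icc s (s + a) := Icc_subset_Icc_right (by linarith)
  have hB : Metric.closedBall x₀ b' ⊆ Metric.closedBall x₀ b :=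
    Metric.closedBall_subset_closedBall hb
  have hμ := Measure.restrict_mono hI (le_refl (volume : Measure ℝ))
  refine ⟨?_, ?_, ?_⟩
  · exact (h.values.filter_mono (ae_mono hμ)).mono fun t ht y hy => ht y (hB hy)
  · exact (h.usc.filter_mono (ae_mono hμ)).mono fun t ht y hy ε hε =>
      (ht y (hB hy) ε hε).filter_mono (nhdsWithin_mono _ hB)
  · obtain ⟨g, m, hm, hg⟩ := h.selection
    exact ⟨g, m, hm.mono_set hI, fun y hy => ⟨(hg y (hB hy)).1.mono_measure hμ,
      (hg y (hB hy)).2.filter_mono (ae_mono hμ)⟩⟩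

/-- Euler approximations: velocities `u` whose values lie in `F(y, t)` for some `y` that is `ε`-close
to the curve with velocity `u`. -/
theorem FilippovLocalHyp.exists_approx {F : E → ℝ → Set E} {x₀ : E} {s a b M ε : ℝ}
    (h : FilippovLocalHyp F x₀ s a b) (hM : 0 < M) (hMa : M * a ≤ b)
    (hF : ∀ y ∈ Metric.closedBall x₀ b, ∀ t, s ≤ t → ∀ q ∈ F y t, ‖q‖ ≤ M) (hε : 0 < ε) :
    ∃ u : ℝ → E, AEStronglyMeasurable u volume ∧ (∀ᵐ t : ℝ, ‖u t‖ ≤ M) ∧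
      ∀ᵐ t : ℝ, t ∈ Icc s (s + a) → ∃ y ∈ Metric.closedBall x₀ b,
        dist y (x₀ + ∫ τ in s..t, u τ) ≤ ε ∧ u t ∈ F y t := by
  obtain ⟨g, m, -, hg⟩ := h.selection
  -- Step length of the Euler scheme: at speed at most `M` the curve moves at most `ε` per step.
  set η := ε / M with hη
  have hηpos : 0 < η := div_pos hε hM
  have key : ∀ N : ℕ, ∃ u : ℝ → E, AEStronglyMeasurable u volume ∧ (∀ᵐ t : ℝ, ‖u t‖ ≤ M) ∧
      ∀ᵐ t : ℝ, t ∈ Icc s (s + a) → t ≤ s + N * η → ∃ y ∈ Metric.closedBall x₀ b,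
        dist y (x₀ + ∫ τ in s..t, u τ) ≤ ε ∧ u t ∈ F y t := by
    intro N
    induction N with
    | zero =>
      refine ⟨fun _ => 0, aestronglyMeasurable_const, by simpa using hM.le, ?_⟩
      have : ∀ᵐ t : ℝ, t ≠ s := by simp [ae_iff, measure_singleton]
      filter_upwards [this] with t ht hts hle
      exact absurd (le_antisymm (by simpa using hle) hts.1) ht
    | succ N ih =>
      obtain ⟨u, hum, huM, hu⟩ := ih
      set σ := s + N * η with hσ
      have hsσ : s ≤ σ := by rw [hσ]; have := hηpos.le; simp; positivity
      rcases le_or_gt (s + a) σ with hend | hend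
      · exact ⟨u, hum, huM, hu.mono fun t ht hts _ => ht hts (hts.2.trans hend)⟩
      set y := x₀ + ∫ τ in s..σ, u τ with hy
      have hyb : y ∈ Metric.closedBall x₀ b := by
        rw [mem_closedBall_iff_norm, hy, add_sub_cancel_left]
        refine (intervalIntegral.norm_integral_le_of_norm_le_const_ae
          (huM.mono fun t ht _ => ht)).trans ?_
        rw [abs_of_nonneg (by linarith)]
        exact le_trans (by gcongr; linarith) hMa
      obtain ⟨hgm, hgF⟩ := hg y hyb
      rw [ae_restrict_iff' measurableSet_Icc] at hgF
      classical
      -- After `σ` the state is frozen at the node `y`; the inclusion with error `ε` is claimed only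
      -- up to `σ + η`.
      set u' : ℝ → E := (Iic σ).piecewise u ((Icc s (s + a)).indicator (g y)) with hu'
      have hu'm : AEStronglyMeasurable u' volume :=
        AEStronglyMeasurable.piecewise measurableSet_Iic hum.restrict
          ((aestronglyMeasurable_indicator_iff measurableSet_Icc).2 hgm).restrict
      have hu'M : ∀ᵐ t : ℝ, ‖u' t‖ ≤ M := by
        filter_upwards [huM, hgF] with t h1 h2
        by_cases hts : t ≤ σ
        · rwa [hu', piecewise_eq_of_mem _ _ _ (mem_Iic.2 hts)]
        · rw [hu', piecewise_eq_of_notMem _ _ _ (by simpa using hts)]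
          by_cases hta : t ∈ Icc s (s + a)
          · rw [indicator_of_mem hta]
            exact hF y hyb t hta.1 _ (h2 hta).1
          · rw [indicator_of_notMem hta, norm_zero]
            exact hM.le
      have hint : ∀ t, s ≤ t → t ≤ σ → ∫ τ in s..t, u' τ = ∫ τ in s..t, u τ := by
        intro t hst hts
        refine intervalIntegral.integral_congr fun τ hτ => ?_
        rw [uIcc_of_le hst] at hτ
        exact piecewise_eq_of_mem _ _ _ (mem_Iic.2 (hτ.2.trans hts))
      refine ⟨u', hu'm, hu'M, ?_⟩
      filter_upwards [hu, hgF] with t h1 h2 hta hle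
      by_cases hts : t ≤ σ
      · rw [hint t hta.1 hts, hu', piecewise_eq_of_mem _ _ _ (mem_Iic.2 hts)]
        exact h1 hta hts
      · refine ⟨y, hyb, ?_, ?_⟩
        · push Not at hts
          have hi := intervalIntegrable_of_ae_norm_le hu'm hu'M
          rw [hy, dist_add_left, ← hint σ hsσ le_rfl, dist_comm, dist_eq_norm,
            ← intervalIntegral.integral_add_adjacent_intervals (hi s σ) (hi σ t),
            add_sub_cancel_left]
          refine (intervalIntegral.norm_integral_le_of_norm_le_const_ae
            (hu'M.mono fun t ht _ => ht)).trans ?_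
          rw [abs_of_pos (sub_pos.2 hts)]
          have : t - σ ≤ η := by
            rw [hσ]
            push_cast at hle
            linarith
          calc M * (t - σ) ≤ M * η := by gcongr
            _ = ε := by rw [hη]; field_simp
        · rw [hu', piecewise_eq_of_notMem _ _ _ (by simpa using hts), indicator_of_mem hta]
          exact (h2 hta).1
  obtain ⟨N, hN⟩ := exists_nat_ge (a / η)
  obtain ⟨u, hum, huM, hu⟩ := key N
  refine ⟨u, hum, huM, hu.mono fun t ht hta => ht hta ?_⟩
  rw [div_le_iff₀ hηpos] at hN
  linarith [hta.2]

/-- Equi-Lipschitz curves with values in a compact set have a subsequence that converges pointwise on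
a given interval to a curve with the same Lipschitz constant. -/
theorem exists_subseq_tendsto_of_lipschitzWith [FiniteDimensional ℝ E] {x : ℕ → ℝ → E}
    {K : NNReal} {a b : ℝ} (hab : a ≤ b) {S : Set E} (hS : IsCompact S) (hx : ∀ k, LipschitzWith K (x k))
    (hxS : ∀ k, ∀ t ∈ Icc a b, x k t ∈ S) :
    ∃ (y : ℝ → E) (φ : ℕ → ℕ), LipschitzWith K y ∧ StrictMono φ ∧
      ∀ t ∈ Icc a b, Tendsto (fun k => x (φ k) t) atTop (𝓝 (y t)) := by
  let f : ℕ → BoundedContinuousFunction (Icc a b) E := fun k =>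
    BoundedContinuousFunction.mkOfCompact
      ⟨fun t => x k t, (hx k).continuous.comp continuous_subtype_val⟩
  have hcomp : IsCompact (closure (range f)) := by
    refine BoundedContinuousFunction.arzela_ascoli S hS _ ?_ ?_
    · rintro _ t ⟨k, rfl⟩
      exact hxS k t t.2
    · refine (LipschitzWith.uniformEquicontinuous _ K ?_).equicontinuous
      rintro ⟨_, k, rfl⟩
      have := (hx k).comp (LipschitzWith.subtype_val (Icc a b))
      rwa [mul_one] at this
  obtain ⟨l, -, φ, hφ, hl⟩ := hcomp.tendsto_subseq fun k =>
    subset_closure (mem_range_self (f := f) k)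
  have hpt : ∀ t : Icc a b, Tendsto (fun k => x (φ k) t) atTop (𝓝 (l t)) := fun t =>
    (BoundedContinuousFunction.tendsto_iff_tendstoUniformly.1 hl).tendsto_at t
  refine ⟨IccExtend hab l, φ, ?_, hφ, ?_⟩
  · refine LipschitzWith.of_dist_le_mul fun s t => ?_
    have h1 : dist (l (projIcc a b hab s)) (l (projIcc a b hab t)) ≤
        K * dist (projIcc a b hab s) (projIcc a b hab t) :=
      le_of_tendsto ((hpt _).dist (hpt _)) (Eventually.of_forall fun k => (hx _).dist_le_mul _ _)
    refine h1.trans ?_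
    gcongr
    simpa using (LipschitzWith.projIcc hab).dist_le_mul s t
  · intro t ht
    rw [IccExtend_of_mem hab l ht]
    exact hpt ⟨t, ht⟩

/-- Filippov's local existence theorem, for a bounded right-hand side. -/
theorem FilippovLocalHyp.exists_solution [FiniteDimensional ℝ E] {F : E → ℝ → Set E} {x₀ : E}
    {s a b M : ℝ} (h : FilippovLocalHyp F x₀ s a b) (ha : 0 < a) (hM : 0 < M) (hMa : M * a ≤ b)
    (hF : ∀ y ∈ Metric.closedBall x₀ b, ∀ t, s ≤ t → ∀ q ∈ F y t, ‖q‖ ≤ M) :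
    ∃ x : ℝ → E, x s = x₀ ∧ LipschitzWith M.toNNReal x ∧
      ∀ᵐ t : ℝ, t ∈ Icc s (s + a) → ∃ v ∈ F (x t) t, HasDerivAt x v t := by
  have hsa : s ≤ s + a := by linarith
  choose u hum huM hu using fun k : ℕ =>
    h.exists_approx hM hMa hF (Nat.one_div_pos_of_nat (α := ℝ) (n := k))
  have hi := fun k => intervalIntegrable_of_ae_norm_le (hum k) (huM k)
  set z : ℕ → ℝ → E := fun k t => x₀ + ∫ τ in s..t, u k τ with hz
  have hzsub : ∀ k t t', z k t' - z k t = ∫ τ in t..t', u k τ := fun k t t' => by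
    rw [hz]
    simp only [add_sub_add_left_eq_sub]
    exact intervalIntegral.integral_interval_sub_left (hi k _ _) (hi k _ _)
  have hzL : ∀ k, LipschitzWith M.toNNReal (z k) := fun k =>
    LipschitzWith.of_dist_le_mul fun t t' => by
      rw [dist_eq_norm, hzsub, Real.coe_toNNReal _ hM.le, Real.dist_eq]
      exact intervalIntegral.norm_integral_le_of_norm_le_const_ae ((huM k).mono fun τ hτ _ => hτ)
  have hzs : ∀ k, z k s = x₀ := fun k => by simp [hz]
  have hzb : ∀ k, ∀ t ∈ Icc s (s + a), z k t ∈ Metric.closedBall x₀ b := fun k t ht => by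
    have := (hzL k).dist_le_mul t s
    rw [hzs, Real.coe_toNNReal _ hM.le, Real.dist_eq, abs_of_nonneg (sub_nonneg.2 ht.1)] at this
    refine this.trans (le_trans ?_ hMa)
    gcongr
    linarith [ht.2]
  obtain ⟨x, φ, hxL, hφ, hx⟩ := exists_subseq_tendsto_of_lipschitzWith hsa
    (isCompact_closedBall x₀ b) hzL hzb
  have hxs : x s = x₀ :=
    tendsto_nhds_unique (hx s (left_mem_Icc.2 hsa)) (by simp only [hzs]; exact tendsto_const_nhds)
  refine ⟨x, hxs, hxL, ?_⟩
  have hD := ae_hasDerivAt_mem_of_tendsto_integral (x := x) (u := fun k => u (φ k)) (a := s)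
    (b := s + a) (M := M) (fun k => hum _) (fun k => huM _) fun t ht t' ht' =>
      ((hx t' ht').sub (hx t ht)).congr fun k => hzsub _ _ _
  have hval := h.values
  have husc := h.usc
  rw [ae_restrict_iff' measurableSet_Icc] at hval husc
  have hne : ∀ c : ℝ, ∀ᵐ t : ℝ, t ≠ c := fun c => by simp [ae_iff, measure_singleton]
  filter_upwards [hD, hval, husc, hxL.ae_differentiableAt_real, hne s, hne (s + a),
    ae_all_iff.2 hu] with t h1 h2 h3 h4 h5 h6 h7 hta
  refine ⟨deriv x t, ?_, h4.hasDerivAt⟩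
  have hxt : x t ∈ Metric.closedBall x₀ b :=
    Metric.isClosed_closedBall.mem_of_tendsto (hx t hta) (Eventually.of_forall fun k => hzb _ t hta)
  obtain ⟨hFne, hFcl, hFconv⟩ := h2 hta _ hxt
  have hFM := hF _ hxt t hta.1
  choose y hyb hyd hyF using fun k => h7 k hta
  have hylim : Tendsto (fun k => y (φ k)) atTop (𝓝[Metric.closedBall x₀ b] (x t)) := by
    refine tendsto_nhdsWithin_iff.2 ⟨?_, Eventually.of_forall fun k => hyb _⟩
    refine (tendsto_iff_of_dist ?_).2 (hx t hta)
    exact squeeze_zero (fun k => dist_nonneg) (fun k => hyd _)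
      ((tendsto_one_div_add_atTop_nhds_zero_nat (𝕜 := ℝ)).comp hφ.tendsto_atTop)
  -- Upper semicontinuity puts the approximate velocities eventually into this closed convex bounded
  -- set, hence also the derivative of the limit; closedness of `F (x t) t` then removes `ε`.
  have hcth : ∀ ε > 0, deriv x t ∈ Metric.cthickening ε (F (x t) t) := by
    intro ε hε
    refine h1 ⟨lt_of_le_of_ne hta.1 (Ne.symm h5), lt_of_le_of_ne hta.2 h6⟩ _ h4.hasDerivAt _
      Metric.isClosed_cthickening (hFconv.cthickening ε) ?_ ?_
    · have hb : Bornology.IsBounded (F (x t) t) := isBounded_iff_forall_norm_le.2 ⟨M, hFM⟩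
      exact isBounded_iff_forall_norm_le.1 hb.cthickening
    · filter_upwards [hylim.eventually (h3 hta _ hxt ε hε)] with k hk
      exact Metric.thickening_subset_cthickening _ _ (hk (hyF _))
  rw [← hFcl.closure_eq, Metric.closure_eq_iInter_cthickening]
  exact mem_iInter₂.2 hcth

end Existence

theorem ae_ne_real (c : ℝ) : ∀ᵐ t : ℝ, t ≠ c := by simp [ae_iff, measure_singleton]

/-! ### Maximal solutions -/

section Maximal

variable {E : Type*} [NormedAddCommGroup E] [NormedSpace ℝ E]

theorem left_mem_timeInterval {t₀ : ℝ} {T : EReal} (h : (t₀ : EReal) < T) :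
    t₀ ∈ timeInterval t₀ T := ⟨le_rfl, h⟩

theorem mem_timeInterval_of_le {t₀ s t : ℝ} {T : EReal} (ht : t ∈ timeInterval t₀ T)
    (hs : t₀ ≤ s) (hst : s ≤ t) : s ∈ timeInterval t₀ T :=
  ⟨hs, lt_of_le_of_lt (EReal.coe_le_coe_iff.2 hst) ht.2⟩

/-- The interval is open on the right, so away from `t₀` it is a neighbourhood of each of its
points. -/
theorem hasDerivAt_congr_timeInterval {x y : ℝ → E} {t₀ t : ℝ} {T : EReal} {v : E}
    (h : EqOn y x (timeInterval t₀ T)) (ht : t ∈ timeInterval t₀ T) (hne : t ≠ t₀)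
    (hx : HasDerivAt x v t) : HasDerivAt y v t := by
  obtain ⟨q, hq, hqT⟩ := EReal.lt_iff_exists_rat_btwn.1 ht.2
  refine hx.congr_of_eventuallyEq ?_
  filter_upwards [Ioo_mem_nhds (lt_of_le_of_ne ht.1 (Ne.symm hne))
    (show t < (q : ℝ) by exact_mod_cast hq)] with s hs
  refine h ⟨hs.1.le, lt_trans ?_ hqT⟩
  exact_mod_cast hs.2

/-- Every solution extends to a maximal one. -/
theorem IsInclusionSolution.exists_maximal {F : E → ℝ → Set E} {t₀ : ℝ} {T : EReal} {x : ℝ → E}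
    (hx : IsInclusionSolution F t₀ T x) :
    ∃ (T' : EReal) (y : ℝ → E), IsMaximalInclusionSolution F t₀ T' y ∧ T ≤ T' ∧
      EqOn y x (timeInterval t₀ T) := by
  classical
  let A := {p : EReal × (ℝ → E) // IsInclusionSolution F t₀ p.1 p.2 ∧ T ≤ p.1 ∧
    EqOn p.2 x (timeInterval t₀ T)}
  -- Only a preorder, since values outside the interval are arbitrary; Zorn's lemma is used in the
  -- form for transitive relations.
  let R : A → A → Prop := fun p q => p.1.1 ≤ q.1.1 ∧ EqOn q.1.2 p.1.2 (timeInterval t₀ p.1.1)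
  have htrans : ∀ {p q s : A}, R p q → R q s → R p s := fun {p q s} h h' =>
    ⟨h.1.trans h'.1, fun t ht => (h'.2 ⟨ht.1, ht.2.trans_le h.1⟩).trans (h.2 ht)⟩
  have hchain : ∀ c : Set A, IsChain R c → ∃ ub, ∀ p ∈ c, R p ub := by
    intro c hc
    rcases c.eq_empty_or_nonempty with rfl | ⟨p₀, hp₀⟩
    · exact ⟨⟨(T, x), hx, le_rfl, fun _ _ => rfl⟩, by simp⟩
    have hagree : ∀ p ∈ c, ∀ q ∈ c, ∀ t, t ∈ timeInterval t₀ p.1.1 → t ∈ timeInterval t₀ q.1.1 →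
        p.1.2 t = q.1.2 t := by
      intro p hp q hq t htp htq
      by_cases hpq : p = q
      · rw [hpq]
      rcases hc hp hq hpq with h | h
      · exact (h.2 htp).symm
      · exact h.2 htq
    let S : EReal := sSup ((fun p : A => p.1.1) '' c)
    let y : ℝ → E := fun t =>
      if h : ∃ p ∈ c, t ∈ timeInterval t₀ p.1.1 then h.choose.1.2 t else 0
    have hy : ∀ p ∈ c, EqOn y p.1.2 (timeInterval t₀ p.1.1) := by
      intro p hp t ht
      have h : ∃ p ∈ c, t ∈ timeInterval t₀ p.1.1 := ⟨p, hp, ht⟩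
      simp only [y, dif_pos h]
      exact hagree _ h.choose_spec.1 _ hp t h.choose_spec.2 ht
    have hS : ∀ p ∈ c, p.1.1 ≤ S := fun p hp => le_sSup (mem_image_of_mem _ hp)
    have hex : ∀ s : ℝ, (s : EReal) < S → ∃ p ∈ c, (s : EReal) < p.1.1 := by
      intro s hs
      obtain ⟨_, ⟨p, hp, rfl⟩, h⟩ := lt_sSup_iff.1 hs
      exact ⟨p, hp, h⟩
    have hsol : IsInclusionSolution F t₀ S y := by
      refine ⟨p₀.2.1.lt.trans_le (hS _ hp₀), fun b hb => ?_, ?_⟩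
      · obtain ⟨p, hp, hbp⟩ := hex b hb.2
        refine (p.2.1.absCont b ⟨hb.1, hbp⟩).congr_on fun t ht => hy p hp ?_
        rw [uIcc_of_le hb.1] at ht
        exact mem_timeInterval_of_le ⟨hb.1, hbp⟩ ht.1 ht.2
      -- A chain may be uncountable; exhausting `[t₀, S)` by rational endpoints keeps the
      -- exceptional sets countable in number.
      · have hrat : ∀ q : ℚ, ∀ᵐ t : ℝ, ((q : ℝ) : EReal) < S → t₀ ≤ t → t < q →
            ∃ v ∈ F (y t) t, HasDerivAt y v t := by
          intro q
          by_cases hq : ((q : ℝ) : EReal) < S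
          · obtain ⟨p, hp, hqp⟩ := hex q hq
            filter_upwards [p.2.1.deriv_mem, ae_ne_real t₀] with t h1 hne _ ht htq
            have hm : t ∈ timeInterval t₀ p.1.1 :=
              ⟨ht, lt_trans (EReal.coe_lt_coe_iff.2 htq) hqp⟩
            obtain ⟨v, hv, hd⟩ := h1 hm
            exact ⟨v, by rwa [hy p hp hm], hasDerivAt_congr_timeInterval (hy p hp) hm hne hd⟩
          · exact Eventually.of_forall fun t h => absurd h hq
        filter_upwards [ae_all_iff.2 hrat] with t h ht
        obtain ⟨q, hq, hqS⟩ := EReal.lt_iff_exists_rat_btwn.1 ht.2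
        exact h q hqS ht.1 (by exact_mod_cast hq)
    refine ⟨⟨(S, y), hsol, p₀.2.2.1.trans (hS _ hp₀), fun t ht => ?_⟩,
      fun p hp => ⟨hS p hp, hy p hp⟩⟩
    exact (hy p₀ hp₀ ⟨ht.1, ht.2.trans_le p₀.2.2.1⟩).trans (p₀.2.2.2 ht)
  obtain ⟨m, hm⟩ := exists_maximal_of_chains_bounded hchain htrans
  refine ⟨m.1.1, m.1.2, ⟨m.2.1, fun T' y hy hT' hEq => ?_⟩, m.2.2.1, m.2.2.2⟩
  refine le_antisymm ?_ hT'
  refine (hm ⟨(T', y), hy, m.2.2.1.trans hT', fun t ht => ?_⟩ ⟨hT', hEq⟩).1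
  exact (hEq ⟨ht.1, ht.2.trans_le m.2.2.1⟩).trans (m.2.2.2 ht)

end Maximal

/-! ### Solutions in bounded regions -/

section Bounded

variable {E : Type*} [NormedAddCommGroup E] [InnerProductSpace ℝ E]

/-- A solution along which the right-hand side is bounded is Lipschitz. -/
theorem IsInclusionSolution.lipschitzOnWith {F : E → ℝ → Set E} {t₀ : ℝ} {T : EReal} {x : ℝ → E}
    (hx : IsInclusionSolution F t₀ T x) {M : ℝ} (hM : 0 ≤ M)
    (hF : ∀ t ∈ timeInterval t₀ T, ∀ q ∈ F (x t) t, ‖q‖ ≤ M) :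
    LipschitzOnWith M.toNNReal x (timeInterval t₀ T) := by
  have key : ∀ s ∈ timeInterval t₀ T, ∀ t ∈ timeInterval t₀ T, s ≤ t →
      ‖x t - x s‖ ≤ M * (t - s) := by
    intro s hs t ht hst
    refine ((hx.absCont t ht).mono ?_).norm_sub_le hst ?_
    · rw [uIcc_of_le hst, uIcc_of_le ht.1]
      exact Icc_subset_Icc_left hs.1
    · filter_upwards [hx.deriv_mem] with τ h hτ
      have hm := mem_timeInterval_of_le ht (hs.1.trans hτ.1) hτ.2
      obtain ⟨v, hv, hd⟩ := h hm
      exact ⟨v, hF τ hm v hv, hd⟩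
  refine LipschitzOnWith.of_dist_le_mul fun s hs t ht => ?_
  rw [Real.coe_toNNReal _ hM, Real.dist_eq]
  rcases le_total s t with h | h
  · rw [dist_comm, dist_eq_norm, abs_sub_comm, abs_of_nonneg (sub_nonneg.2 h)]
    exact key s hs t ht h
  · rw [dist_eq_norm, abs_of_nonneg (sub_nonneg.2 h)]
    exact key t ht s hs h

/-- A solution on a bounded time interval that stays in a compact subset of a region where the
right-hand side is locally bounded can be continued. -/
theorem IsInclusionSolution.exists_extension [FiniteDimensional ℝ E] {F : E → ℝ → Set E}
    {D K : Set E} {t₀ τ : ℝ} {x : ℝ → E} (hx : IsInclusionSolution F t₀ τ x) (hD : IsOpen D)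
    (hK : IsCompact K) (hKD : K ⊆ D) (hex : ExistenceAssumption F t₀)
    (hbdd : LocallyBoundedUniformly F D t₀) (hxK : ∀ t ∈ timeInterval t₀ τ, x t ∈ K) :
    ∃ τ' : ℝ, τ < τ' ∧ ∃ y : ℝ → E, IsInclusionSolution F t₀ τ' y ∧
      EqOn y x (timeInterval t₀ τ) := by
  have ht₀τ : t₀ < τ := EReal.coe_lt_coe_iff.1 hx.lt
  have hmem : ∀ t, t ∈ timeInterval t₀ τ ↔ t₀ ≤ t ∧ t < τ := fun t => by simp [timeInterval]
  obtain ⟨M, hM, hFM⟩ := hbdd K hKD hK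
  -- The Lipschitz extension `z` supplies the left limit of `x` at `τ` as `z τ`.
  obtain ⟨z, hzL, hzx⟩ := (hx.lipschitzOnWith hM.le fun t ht q hq =>
    hFM _ (hxK t ht) t ht.1 q hq).extend_finite_dimension
  have hzτ : z τ ∈ K := by
    refine hK.isClosed.mem_of_tendsto (b := 𝓝[<] τ)
      ((hzL.continuous.tendsto τ).mono_left nhdsWithin_le_nhds) ?_
    filter_upwards [Ioo_mem_nhdsLT ht₀τ] with t ht
    have hm := (hmem t).2 ⟨ht.1.le, ht.2⟩
    rw [← hzx hm]
    exact hxK t hm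
  obtain ⟨a, ha, b, hb, hloc⟩ := hex (z τ) τ ht₀τ.le
  obtain ⟨ρ, hρ, hρD⟩ := Metric.nhds_basis_closedBall.mem_iff.1 (hD.mem_nhds (hKD hzτ))
  obtain ⟨M', hM', hFM'⟩ := hbdd _ hρD (isCompact_closedBall _ _)
  set b' := min b ρ with hb'
  have hb'pos : 0 < b' := lt_min hb hρ
  set a' := min a (b' / M') with ha'
  have ha'pos : 0 < a' := lt_min ha (div_pos hb'pos hM')
  have hMa : M' * a' ≤ b' := by
    have := min_le_right a (b' / M')
    rw [le_div_iff₀ hM'] at this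
    linarith
  obtain ⟨w, hwτ, hwL, hw⟩ := (hloc.mono (min_le_left a (b' / M')) (min_le_left b ρ)).exists_solution
    ha'pos hM' hMa fun y hy t ht q hq =>
      hFM' y (Metric.closedBall_subset_closedBall (min_le_right _ _) hy) t (ht₀τ.le.trans ht) q hq
  -- Gluing by clamped times makes `y` globally Lipschitz without cases.
  set y : ℝ → E := fun t => z (min t τ) + (w (max t τ) - w τ) with hy
  have hyz : ∀ t, t ≤ τ → y t = z t := fun t ht => by simp [hy, ht]
  have hyw : ∀ t, τ ≤ t → y t = w t := fun t ht => by simp [hy, ht, hwτ]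
  have hyx : EqOn y x (timeInterval t₀ τ) := fun t ht => by
    rw [hyz t ((hmem t).1 ht).2.le, hzx ht]
  have hyL : ∃ L, LipschitzWith L y :=
    ⟨_, (hzL.comp (LipschitzWith.id.min_const τ)).add
      ((hwL.comp (LipschitzWith.id.max_const τ)).sub (LipschitzWith.const (w τ)))⟩
  obtain ⟨L, hL⟩ := hyL
  refine ⟨τ + a', by linarith, y, ⟨EReal.coe_lt_coe_iff.2 (by linarith),
    fun _ _ => hL.lipschitzOnWith.absolutelyContinuousOnInterval, ?_⟩, hyx⟩
  filter_upwards [hx.deriv_mem, hw, ae_ne_real t₀, ae_ne_real τ] with t h1 h2 h3 h4 ht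
  rcases lt_or_gt_of_ne h4 with hlt | hgt
  · have hm := (hmem t).2 ⟨ht.1, hlt⟩
    obtain ⟨v, hv, hd⟩ := h1 hm
    exact ⟨v, by rwa [hyx hm], hasDerivAt_congr_timeInterval hyx hm h3 hd⟩
  · obtain ⟨v, hv, hd⟩ := h2 ⟨hgt.le, (EReal.coe_lt_coe_iff.1 ht.2).le⟩
    refine ⟨v, by rwa [hyw t hgt.le], hd.congr_of_eventuallyEq ?_⟩
    filter_upwards [Ioi_mem_nhds hgt] with s hs
    exact hyw s (le_of_lt hs)

end Bounded

/-! ### Lyapunov functions along solutions -/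

/-- A locally Lipschitz function composed with an absolutely continuous curve is absolutely
continuous. -/
theorem LocallyLipschitzOn.absolutelyContinuousOnInterval_comp {E : Type*} [NormedAddCommGroup E]
    {D : Set E} {t₀ b : ℝ}
    {U : E × ℝ → ℝ} {x : ℝ → E} (hU : LocallyLipschitzOn (D ×ˢ Ici t₀) U) (htb : t₀ ≤ b)
    (hx : AbsolutelyContinuousOnInterval x t₀ b) (hxD : ∀ t ∈ Icc t₀ b, x t ∈ D) :
    AbsolutelyContinuousOnInterval (fun t => U (x t, t)) t₀ b := by
  have hcont : ContinuousOn (fun t => (x t, t)) (uIcc t₀ b) := hx.continuousOn.prodMk continuousOn_id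
  have hsub : (fun t => (x t, t)) '' uIcc t₀ b ⊆ D ×ˢ Ici t₀ := by
    rintro _ ⟨t, ht, rfl⟩
    rw [uIcc_of_le htb] at ht
    exact ⟨hxD t ht, ht.1⟩
  -- The graph of the curve over `[t₀, b]` is compact, so one Lipschitz constant suffices.
  obtain ⟨K, hK⟩ := (hU.mono hsub).exists_lipschitzOnWith_of_compact
    (isCompact_uIcc.image_of_continuousOn hcont)
  refine hx.of_dist_le (K := K) fun s hs t ht => ?_
  refine (hK.dist_le_mul _ (mem_image_of_mem _ hs) _ (mem_image_of_mem _ ht)).trans ?_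
  gcongr
  rw [Prod.dist_eq]
  exact max_le_add_of_nonneg dist_nonneg dist_nonneg

theorem IsContPosDef.nonneg {E : Type*} [NormedAddCommGroup E]
    {D : Set E} {w : E → ℝ} (h : IsContPosDef D w) {y : E} (hy : y ∈ D) :
    0 ≤ w y := by
  by_cases h0 : y = 0
  · rw [h0, h.2.1]
  · exact (h.2.2 y hy h0).le

section Lyapunov

variable {E : Type*} [NormedAddCommGroup E] [NormedSpace ℝ E]

/-- Along a curve, the time derivative of a regular function is the common value of its generalized
gradient at the velocity, for almost every time. -/
theorem IsLipschitzRegular.ae_apply_eq_deriv {D : Set E} {t₀ b : ℝ} {U : E × ℝ → ℝ} {x : ℝ → E}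
    (hU : IsLipschitzRegular D t₀ U) (hD : IsOpen D) (htb : t₀ ≤ b)
    (hx : AbsolutelyContinuousOnInterval x t₀ b) (hxD : ∀ t ∈ Icc t₀ b, x t ∈ D) :
    ∀ᵐ t : ℝ, t ∈ Icc t₀ b → ∀ v, HasDerivAt x v t → ∀ p ∈ clarkeGradient U (x t, t),
      p (v, 1) = deriv (fun t => U (x t, t)) t := by
  have hAC := hU.1.absolutelyContinuousOnInterval_comp htb hx hxD
  filter_upwards [hAC.ae_differentiableAt, ae_ne_real t₀] with t hdiff hne ht v hv p hp
  have hlt : t₀ < t := lt_of_le_of_ne ht.1 (Ne.symm hne)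
  rw [uIcc_of_le htb] at hdiff
  obtain ⟨K, s, hs, hK⟩ := hU.1 (show (x t, t) ∈ D ×ˢ Ici t₀ from ⟨hxD t ht, ht.1⟩)
  rw [nhdsWithin_eq_nhds.2 (prod_mem_nhds (hD.mem_nhds (hxD t ht)) (Ici_mem_nhds hlt))] at hs
  exact (hU.2 (x t, t) ⟨hxD t ht, hlt⟩).apply_eq_of_hasDerivAt (γ := fun t => (x t, t)) hs hK
    (hv.prodMk (hasDerivAt_id t)) (hdiff ht).hasDerivAt hp

/-- A non-strict Lyapunov function decreases along solutions at least at the rate `W`. -/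
theorem IsReducedNonStrictLyapunov.add_integral_le {D : Set E} {t₀ b : ℝ} {F : E → ℝ → Set E}
    {𝒱 : Set (E × ℝ → ℝ)} {V : E × ℝ → ℝ} {Wup Wlow W : E → ℝ} {T : EReal} {x : ℝ → E}
    (hV : IsReducedNonStrictLyapunov D t₀ F 𝒱 V Wup Wlow W) (hD : IsOpen D)
    (hx : IsInclusionSolution F t₀ T x) (hb : b ∈ timeInterval t₀ T)
    (hxD : ∀ t ∈ Icc t₀ b, x t ∈ D) :
    V (x b, b) + ∫ t in t₀..b, W (x t) ≤ V (x t₀, t₀) := by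
  have htb := hb.1
  have hxAC := hx.absCont b hb
  have hAC := hV.regular.1.absolutelyContinuousOnInterval_comp htb hxAC hxD
  have hWc : ContinuousOn (fun t => W (x t)) (uIcc t₀ b) :=
    hV.rate_cont.comp hxAC.continuousOn fun t ht => hxD t (by rwa [uIcc_of_le htb] at ht)
  -- Countability of `𝒱` gives a null set common to all `U`.
  have hfam : ∀ᵐ t : ℝ, ∀ U ∈ 𝒱, t ∈ Icc t₀ b → ∀ v, HasDerivAt x v t →
      ∀ p ∈ clarkeGradient U (x t, t), p (v, 1) = deriv (fun t => U (x t, t)) t :=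
    (ae_ball_iff hV.countable).2 fun U hU =>
      (hV.family_regular U hU).ae_apply_eq_deriv hD htb hxAC hxD
  have hdec := hV.decrease
  rw [ae_restrict_iff' measurableSet_Ici] at hdec
  have hle : ∫ t in t₀..b, deriv (fun t => V (x t, t)) t ≤ ∫ t in t₀..b, -W (x t) := by
    refine intervalIntegral.integral_mono_ae_restrict htb hAC.intervalIntegrable_deriv
      hWc.intervalIntegrable.neg ?_
    refine (ae_restrict_iff' measurableSet_Icc).2 ?_
    filter_upwards [hfam, hV.regular.ae_apply_eq_deriv hD htb hxAC hxD, hdec, hx.deriv_mem]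
      with t h1 h2 h3 h4 ht
    obtain ⟨v, hv, hd⟩ := h4 (mem_timeInterval_of_le hb ht.1 ht.2)
    have hred : v ∈ reducedInclusion F 𝒱 (x t) t :=
      ⟨hv, mem_iInter₂.2 fun U hU => ⟨hv, _, h1 U hU ht v hd⟩⟩
    refine EReal.coe_le_coe_iff.1 (le_trans ?_ (h3 ht.1 (x t) (hxD t ht)))
    -- Every `p` has the value `V̇` at `(v, 1)`, so each inner supremum is at least `V̇`;
    -- nonemptiness of the gradient plays no role.
    refine le_iInf₂ fun p hp => ?_
    rw [← h2 ht v hd p hp]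
    exact le_iSup₂ (f := fun q (_ : q ∈ reducedInclusion F 𝒱 (x t) t) => ((p (q, 1) : ℝ) : EReal))
      v hred
  rw [hAC.integral_deriv_eq_sub, intervalIntegral.integral_neg] at hle
  linarith

/-- Solutions starting in a sublevel set inside the ball of radius `r` stay in this ball. -/
theorem IsReducedNonStrictLyapunov.norm_lt {D : Set E} {t₀ : ℝ} {F : E → ℝ → Set E}
    {𝒱 : Set (E × ℝ → ℝ)} {V : E × ℝ → ℝ} {Wup Wlow W : E → ℝ} {T : EReal} {x : ℝ → E}
    (hV : IsReducedNonStrictLyapunov D t₀ F 𝒱 V Wup Wlow W) (hD : IsOpen D)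
    (hx : IsInclusionSolution F t₀ T x) {r c : ℝ} (hrD : Metric.closedBall 0 r ⊆ D)
    (hcr : ∀ y ∈ Metric.sphere 0 r, c < Wlow y) (hx₀ : ‖x t₀‖ < r) (hc : Wup (x t₀) ≤ c)
    {t : ℝ} (ht : t ∈ timeInterval t₀ T) : ‖x t‖ < r := by
  by_contra! hcon
  have hcont : ContinuousOn (fun s => ‖x s‖) (Icc t₀ t) := by
    have := (hx.absCont t ht).continuousOn
    rw [uIcc_of_le ht.1] at this
    exact this.norm
  -- At the first time of reaching the sphere, the curve is still in the closed ball, hence in `D`,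
  -- so the decrease estimate applies up to `τ`.
  obtain ⟨τ, ⟨hτ, hτr⟩, hmin⟩ : ∃ τ, IsLeast {s ∈ Icc t₀ t | r ≤ ‖x s‖} τ := by
    refine IsCompact.exists_isLeast ?_ ⟨t, right_mem_Icc.2 ht.1, hcon⟩
    exact isCompact_Icc.of_isClosed_subset
      (hcont.preimage_isClosed_of_isClosed isClosed_Icc isClosed_Ici) fun s hs => hs.1
  have hlt : ∀ s ∈ Ico t₀ τ, ‖x s‖ < r := fun s hs => by
    by_contra! h
    exact absurd (hmin ⟨⟨hs.1, hs.2.le.trans hτ.2⟩, h⟩) (not_le.2 hs.2)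
  have hτeq : ‖x τ‖ = r := by
    obtain ⟨σ, hσ, hσr⟩ := intermediate_value_Icc hτ.1 (hcont.mono (Icc_subset_Icc_right hτ.2))
      ⟨hx₀.le, hτr⟩
    dsimp only at hσr
    rcases hσ.2.eq_or_lt with rfl | h
    · exact hσr
    · exact absurd hσr (hlt σ ⟨hσ.1, h⟩).ne
  have hball : ∀ s ∈ Icc t₀ τ, x s ∈ D := fun s hs => hrD <| by
    rw [mem_closedBall_zero_iff]
    rcases hs.2.eq_or_lt with rfl | h
    · exact hτeq.le
    · exact (hlt s ⟨hs.1, h⟩).le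
  have hdec := hV.add_integral_le hD hx (mem_timeInterval_of_le ht hτ.1 hτ.2) hball
  have hW : 0 ≤ ∫ s in t₀..τ, W (x s) :=
    intervalIntegral.integral_nonneg hτ.1 fun s hs => hV.rate_nonneg _ (hball s hs)
  have h1 := (hV.bounds _ (hball τ (right_mem_Icc.2 hτ.1)) τ hτ.1).1
  have h2 := (hV.bounds _ (hball t₀ (left_mem_Icc.2 hτ.1)) t₀ le_rfl).2
  have h3 := hcr (x τ) (mem_sphere_zero_iff_norm.2 hτeq)
  linarith

end Lyapunov

theorem corollary2 (n : ℕ) (t₀ : ℝ) (D : Set (EuclideanSpace ℝ (Fin n)))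
    (hD_open : IsOpen D) (hD_conn : IsConnected D)
    (hD_zero : (0 : EuclideanSpace ℝ (Fin n)) ∈ D)
    (F : EuclideanSpace ℝ (Fin n) → ℝ → Set (EuclideanSpace ℝ (Fin n)))
    (𝒱 : Set (EuclideanSpace ℝ (Fin n) × ℝ → ℝ))
    (V : EuclideanSpace ℝ (Fin n) × ℝ → ℝ)
    (Wup Wlow W : EuclideanSpace ℝ (Fin n) → ℝ)
    (hV : IsReducedNonStrictLyapunov D t₀ F 𝒱 V Wup Wlow W)
    (hF_ex : ExistenceAssumption F t₀)
    (hF_bdd : LocallyBoundedUniformly F D t₀)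
    (r : ℝ) (hr : 0 < r) (hrD : Metric.closedBall 0 r ⊆ D)
    (c : ℝ) (hc : 0 < c) (hcr : ∀ y ∈ Metric.sphere 0 r, c < Wlow y)
    (T : EReal) (x : ℝ → EuclideanSpace ℝ (Fin n))
    (hx : IsInclusionSolution F t₀ T x)
    (hx₀ : x t₀ ∈ {y ∈ Metric.ball 0 r | Wup y ≤ c}) :
    (∃ y : ℝ → EuclideanSpace ℝ (Fin n),
        IsInclusionSolution F t₀ ⊤ y ∧ EqOn y x (timeInterval t₀ T)) ∧
      (IsMaximalInclusionSolution F t₀ T x → T = ⊤) ∧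
      Bornology.IsBounded (x '' timeInterval t₀ T) ∧
      (T = ⊤ → Tendsto (fun t => W (x t)) atTop (𝓝 0)) := by
  have hx₀r : ‖x t₀‖ < r := mem_ball_zero_iff.1 hx₀.1
  -- Stated for any solution with the same initial value, since it is needed for the maximal
  -- extension as well as for `x`.
  have hball : ∀ {S : EReal} {y : ℝ → EuclideanSpace ℝ (Fin n)}, IsInclusionSolution F t₀ S y →
      y t₀ = x t₀ → ∀ t ∈ timeInterval t₀ S, y t ∈ Metric.closedBall 0 r := fun hy h₀ t ht =>
    mem_closedBall_zero_iff.2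
      (hV.norm_lt hD_open hy hrD hcr (h₀ ▸ hx₀r) (h₀ ▸ hx₀.2) ht).le
  have hK : IsCompact (Metric.closedBall (0 : EuclideanSpace ℝ (Fin n)) r) :=
    isCompact_closedBall 0 r
  have hcomplete : ∃ y : ℝ → EuclideanSpace ℝ (Fin n),
      IsInclusionSolution F t₀ ⊤ y ∧ EqOn y x (timeInterval t₀ T) := by
    obtain ⟨S, y, hy, -, hyx⟩ := hx.exists_maximal
    have hS : S = ⊤ := by
      by_contra htop
      lift S to ℝ using ⟨htop, ne_bot_of_gt hy.1.lt⟩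
      obtain ⟨S', hS', w, hw, hwy⟩ := hy.1.exists_extension hD_open hK hrD hF_ex hF_bdd
        (hball hy.1 (hyx (left_mem_timeInterval hx.lt)))
      exact hS'.ne' (EReal.coe_injective (hy.2 S' w hw (EReal.coe_le_coe_iff.2 hS'.le) hwy))
    exact ⟨y, hS ▸ hy.1, hyx⟩
  refine ⟨hcomplete, fun hmax => ?_, ?_, ?_⟩
  · obtain ⟨y, hy, hyx⟩ := hcomplete
    exact (hmax.2 ⊤ y hy le_top hyx).symm
  · exact Metric.isBounded_closedBall.subset (image_subset_iff.2 (hball hx rfl))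
  · rintro rfl
    have htop : timeInterval t₀ ⊤ = Ici t₀ := by
      ext t
      simp [timeInterval, EReal.coe_lt_top]
    have hxb := hball hx rfl
    obtain ⟨M, hM, hFM⟩ := hF_bdd _ hrD hK
    have hL := hx.lipschitzOnWith hM.le fun t ht q hq => hFM _ (hxb t ht) t ht.1 q hq
    rw [htop] at hL hxb
    have hWx : UniformContinuousOn (fun t => W (x t)) (Ici t₀) :=
      (hK.uniformContinuousOn_of_continuous (hV.rate_cont.mono hrD)).comp
        hL.uniformContinuousOn hxb
    -- The initial value of `V` bounds the integrals because `V ≥ Wlow ≥ 0`.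
    refine hWx.tendsto_zero_of_integral_le (C := V (x t₀, t₀))
      (fun t ht => hV.rate_nonneg _ (hrD (hxb t ht))) fun b hb => ?_
    have hdec := hV.add_integral_le hD_open hx (htop ▸ hb) fun t ht => hrD (hxb t ht.1)
    have hlow := (hV.bounds _ (hrD (hxb b hb)) b hb).1
    linarith [hV.lower_posDef.nonneg (hrD (hxb b hb))]
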